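/- Let $n\ge 1$ be an integer, $\alpha\in(0,2)$ and $1<p<\infty$, and write $\mathbb{R}^{n+1}_+=\mathbb{R}^n\times(0,\infty)$. For $f\in L^p(\mathbb{R}^n)$ let $$P_\alpha f(x,t)=c(n,\alpha)\int_{\mathbb{R}^n}\frac{t^{\alpha}}{(|x-y|^2+t^2)^{(n+\alpha)/2}}\,f(y)\,dy,\qquad (x,t)\in\mathbb{R}^{n+1}_+,\qquad c(n,\alpha)=\frac{\Gamma((n+\alpha)/2)}{\pi^{n/2}\,\Gamma(\alpha/2)},$$ be its Caffarelli--Silvestre extension. For $E\subseteq\mathbb{R}^{n+1}_+$ define the $L^p$-capacity $$C^{\alpha,p}_{\mathbb{R}^{n+1}_+}(E)=\inf\left\{\|f\|_{L^p(\mathbb{R}^n)}^p:\ f\in L^p(\mathbb{R}^n),\ f\ge 0,\ P_\alpha f(x,t)\ge 1\text{ for all }(x,t)\in E\right\},$$ with the convention that $C^{\alpha,p}_{\mathbb{R}^{n+1}_+}(E)=0$ if no such $f$ exists. Then there is a finite constant $C$, depending only on $n$, $\alpha$ and $p$, such that for every nonnegative $f\in L^p(\mathbb{R}^n)$, $$\int_0^\infty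 C^{\alpha,p}_{\mathbb{R}^{n+1}_+}\left(\left\{(x,t)\in\mathbb{R}^{n+1}_+:\ P_\alpha f(x,t)\ge\lambda\right\}\right)d\lambda^p\ \le\ C\,\|f\|_{L^p(\mathbb{R}^n)}^p,$$ where $d\lambda^p=p\lambda^{p-1}\,d\lambda$. -/

import Mathlib

open MeasureTheory
open scoped ENNReal NNReal

noncomputable section

namespace CaffarelliSilvestre

/-- `ℝⁿ` with its Euclidean norm. -/
abbrev Euc (n : ℕ) : Type := EuclideanSpace ℝ (Fin n)

/-- The open upper half-space `ℝ^{n+1}_+ = ℝⁿ × (0, ∞)`. -/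
abbrev HalfSpace (n : ℕ) : Type := Euc n × Set.Ioi (0 : ℝ)

/-- The normalizing constant `c(n, α) = Γ((n + α)/2) / (π^{n/2} Γ(α/2))`. -/
def normConst (n : ℕ) (α : ℝ) : ℝ :=
  Real.Gamma (((n : ℝ) + α) / 2) / (Real.pi ^ ((n : ℝ) / 2) * Real.Gamma (α / 2))

/-- The Poisson kernel `p_t^α(x) = c(n, α) t^α / (|x|² + t²)^{(n + α)/2}`. -/
def poissonKernel {n : ℕ} (α t : ℝ) (x : Euc n) : ℝ :=
  normConst n α * t ^ α / (‖x‖ ^ 2 + t ^ 2) ^ (((n : ℝ) + α) / 2)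

/-- The Caffarelli–Silvestre extension `P_α f(x, t) = ∫ p_t^α(x - y) f(y) dy`.
The integral converges absolutely for every `f` in `L^p(ℝⁿ)`, `1 ≤ p < ∞`. -/
def extension {n : ℕ} (α : ℝ) (f : Euc n → ℝ) (z : HalfSpace n) : ℝ :=
  ∫ y, poissonKernel α (z.2 : ℝ) (z.1 - y) * f y

/-- The functions admissible for the capacity of `E`: the nonnegative `f ∈ L^p(ℝⁿ)` with
`P_α f ≥ 1` at every point of `E`. -/
def admissible {n : ℕ} (α p : ℝ) (E : Set (HalfSpace n)) : Set (Euc n → ℝ) :=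
  {f | MemLp f (ENNReal.ofReal p) volume ∧ 0 ≤ᵐ[volume] f ∧ ∀ z ∈ E, 1 ≤ extension α f z}

open Classical in
/-- The `L^p`-capacity of a set `E` in the upper half-space: the infimum of `‖f‖_p^p` over the
admissible functions, with the convention that it is `0` if no function is admissible. -/
def capacity {n : ℕ} (α p : ℝ) (E : Set (HalfSpace n)) : ℝ≥0∞ :=
  if (admissible α p E).Nonempty then
    ⨅ f ∈ admissible α p E, eLpNorm f (ENNReal.ofReal p) volume ^ p
  else 0

end CaffarelliSilvestre

end

namespace CaffarelliSilvestre

open Metric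

variable {n : ℕ} {α p : ℝ}

/-! The proof is the weak-type argument for the maximal function, carried out on tents over balls.
Decomposing the kernel dyadically bounds `P_α f(x,t)` by the largest average of `|f|` over balls
centred at `x` of radius at least `t` (`exists_lintegral_poissonKernel_le`). So if `P_α f(x,t) ≥ λ`,
the ball `B(x,t)` lies in a larger ball where the part of `|f|` above height `λ/K` has average at
least `λ/K`. By Vitali (`mul_volume_biUnion_closedBall_le`), the union `A` of these `B(x,t)` has
volume at most `(C/λ) ∫_{|f| > λ/K} |f|`. A large multiple of the indicator of `A` is admissible for
the superlevel set, so its capacity is at most a constant times `|A|` (`exists_capacity_le`).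
Integrating against `d(λ^p)` by Tonelli gives the strong-type bound, since `p > 1`. -/

lemma normConst_pos (n : ℕ) (hα : 0 < α) : 0 < normConst n α := by
  have h1 : 0 < Real.Gamma (((n : ℝ) + α) / 2) := Real.Gamma_pos_of_pos (by positivity)
  have h2 : 0 < Real.Gamma (α / 2) := Real.Gamma_pos_of_pos (by positivity)
  unfold normConst
  positivity

/-! ### Upper bounds for the Poisson kernel -/

lemma poissonKernel_pos (hα : 0 < α) {t : ℝ} (ht : 0 < t) (x : Euc n) :
    0 < poissonKernel α t x := by
  have := normConst_pos n hα
  unfold poissonKernel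
  positivity

/-- Every point lies in a dyadic dilate of the ball of radius `t` on which the Poisson kernel is
controlled by the reciprocal of the volume, with geometric decay. -/
lemma exists_poissonKernel_le (hα : 0 < α) {t : ℝ} (ht : 0 < t) (x : Euc n) :
    ∃ k : ℕ, ‖x‖ ≤ 2 ^ k * t ∧ poissonKernel α t x ≤
      normConst n α * 2 ^ ((n : ℝ) + α) * ((2 : ℝ) ^ α)⁻¹ ^ k * ((2 ^ k * t) ^ n)⁻¹ := by
  have hc := normConst_pos n hα
  obtain ⟨j, hj1, hj2⟩ := exists_nat_pow_near (x := max ‖x‖ t / t) (y := (2 : ℝ))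
    ((one_le_div ht).2 (le_max_right _ _)) one_lt_two
  rw [le_div_iff₀ ht] at hj1
  rw [div_lt_iff₀ ht] at hj2
  -- The scale `j + 1` contains `x`, while minimality of `j` gives `R / 2 ≤ max ‖x‖ t`; this halving
  -- costs the factor `2 ^ (n + α)`.
  refine ⟨j + 1, (le_max_left _ _).trans hj2.le, ?_⟩
  set R : ℝ := 2 ^ (j + 1) * t with hR
  have hRpos : 0 < R := by positivity
  have hR2 : R / 2 ≤ max ‖x‖ t := by
    rw [hR, pow_succ]; linarith
  have hsq : (R / 2) ^ 2 ≤ ‖x‖ ^ 2 + t ^ 2 := by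
    have h1 : (R / 2) ^ 2 ≤ (max ‖x‖ t) ^ 2 := by gcongr
    rcases max_choice ‖x‖ t with h | h <;> rw [h] at h1 <;> nlinarith [sq_nonneg ‖x‖, sq_nonneg t]
  have hden : R ^ n * (((2 : ℝ) ^ α) ^ (j + 1) * t ^ α) / 2 ^ ((n : ℝ) + α) ≤
      (‖x‖ ^ 2 + t ^ 2) ^ (((n : ℝ) + α) / 2) := by
    calc R ^ n * (((2 : ℝ) ^ α) ^ (j + 1) * t ^ α) / 2 ^ ((n : ℝ) + α)
        = (R / 2) ^ ((n : ℝ) + α) := by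
          rw [Real.div_rpow hRpos.le zero_le_two, Real.rpow_add hRpos, Real.rpow_natCast]
          congr 2
          rw [hR, Real.mul_rpow (by positivity) ht.le, ← Real.rpow_natCast, ← Real.rpow_natCast,
            ← Real.rpow_mul zero_le_two, ← Real.rpow_mul zero_le_two, mul_comm α]
      _ = ((R / 2) ^ 2) ^ (((n : ℝ) + α) / 2) := by
          rw [← Real.rpow_natCast, ← Real.rpow_mul (by positivity)]
          congr 1
          push_cast
          ring
      _ ≤ _ := by gcongr
  unfold poissonKernel
  calc normConst n α * t ^ α / (‖x‖ ^ 2 + t ^ 2) ^ (((n : ℝ) + α) / 2)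
      ≤ normConst n α * t ^ α /
        (R ^ n * (((2 : ℝ) ^ α) ^ (j + 1) * t ^ α) / 2 ^ ((n : ℝ) + α)) := by gcongr
    _ = _ := by
      have : t ^ α ≠ 0 := by positivity
      rw [inv_pow]
      field_simp

lemma volume_closedBall_eq (x : Euc n) {r : ℝ} (hr : 0 ≤ r) :
    volume (closedBall x r) = ENNReal.ofReal (r ^ n) * volume (closedBall (0 : Euc n) 1) := by
  simpa using Measure.addHaar_closedBall' (volume : Measure (Euc n)) x hr

/-- The Poisson integral at `(x, t)` is dominated by the largest average over the balls centred at
`x` of radius at least `t`. -/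
lemma exists_lintegral_poissonKernel_le (n : ℕ) (hα : 0 < α) :
    ∃ B : ℝ≥0, 0 < B ∧ ∀ (x : Euc n) (t : ℝ), 0 < t → ∀ (G : Euc n → ℝ≥0∞) (s : ℝ≥0∞),
      AEMeasurable G volume →
      (∀ r, t ≤ r → ∫⁻ y in closedBall x r, G y ≤ s * volume (closedBall x r)) →
      ∫⁻ y, ‖poissonKernel α t (x - y)‖ₑ * G y ≤ B * s := by
  have hc := normConst_pos n hα
  set c : ℝ := normConst n α * 2 ^ ((n : ℝ) + α) with hcdef
  have hcpos : 0 < c := by positivity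
  set q : ℝ := ((2 : ℝ) ^ α)⁻¹ with hq
  have hq0 : 0 < q := by positivity
  have hq1 : q < 1 := inv_lt_one_of_one_lt₀ (Real.one_lt_rpow one_lt_two hα)
  set w := volume (closedBall (0 : Euc n) 1) with hw
  have hwtop : w ≠ ∞ := measure_closedBall_lt_top.ne
  have hsum : ∑' k : ℕ, ENNReal.ofReal q ^ k ≠ ∞ := by
    rw [ENNReal.tsum_geometric]
    refine ENNReal.inv_ne_top.2 (tsub_pos_of_lt ?_).ne'
    simpa using hq1
  set B₀ : ℝ≥0∞ := ENNReal.ofReal c * w * ∑' k : ℕ, ENNReal.ofReal q ^ k with hB₀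
  have hB₀top : B₀ ≠ ∞ := ENNReal.mul_ne_top (ENNReal.mul_ne_top ENNReal.ofReal_ne_top hwtop) hsum
  refine ⟨B₀.toNNReal + 1, by positivity, fun x t ht G s hG hs => ?_⟩
  set R : ℕ → ℝ := fun k => 2 ^ k * t with hR
  have hRpos : ∀ k, 0 < R k := fun k => by positivity
  have hRt : ∀ k, t ≤ R k := fun k => le_mul_of_one_le_left ht.le (one_le_pow₀ one_le_two)
  set a : ℕ → ℝ≥0∞ := fun k => ENNReal.ofReal (c * q ^ k * (R k ^ n)⁻¹) with ha
  have hpt : ∀ y, ‖poissonKernel α t (x - y)‖ₑ * G y ≤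
      ∑' k, a k * (closedBall x (R k)).indicator G y := by
    intro y
    obtain ⟨k, hk1, hk2⟩ := exists_poissonKernel_le hα ht (x - y)
    refine le_trans ?_ (ENNReal.le_tsum k)
    have hy : y ∈ closedBall x (R k) := by
      rw [mem_closedBall, dist_comm, dist_eq_norm]
      exact hk1
    rw [Set.indicator_of_mem hy, Real.enorm_of_nonneg (poissonKernel_pos hα ht _).le]
    gcongr
    exact ENNReal.ofReal_le_ofReal hk2
  calc ∫⁻ y, ‖poissonKernel α t (x - y)‖ₑ * G y
      ≤ ∫⁻ y, ∑' k, a k * (closedBall x (R k)).indicator G y := lintegral_mono hpt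
    _ = ∑' k, a k * ∫⁻ y in closedBall x (R k), G y := by
        rw [lintegral_tsum fun k => (hG.indicator measurableSet_closedBall).const_mul _]
        congr with k
        rw [lintegral_const_mul'' _ (hG.indicator measurableSet_closedBall),
          lintegral_indicator measurableSet_closedBall]
    _ ≤ ∑' k, a k * (s * volume (closedBall x (R k))) := by
        gcongr with k
        exact hs _ (hRt k)
    _ = ∑' k, ENNReal.ofReal c * w * s * ENNReal.ofReal q ^ k := by
        congr with k
        rw [volume_closedBall_eq x (hRpos k).le, ← hw]
        have : a k * ENNReal.ofReal (R k ^ n) = ENNReal.ofReal c * ENNReal.ofReal q ^ k := by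
          rw [ha, ← ENNReal.ofReal_mul (by have := hRpos k; positivity),
            ← ENNReal.ofReal_pow hq0.le, ← ENNReal.ofReal_mul hcpos.le]
          congr 1
          have := (hRpos k).ne'
          field_simp
        calc a k * (s * (ENNReal.ofReal (R k ^ n) * w))
            = a k * ENNReal.ofReal (R k ^ n) * (s * w) := by ring
          _ = _ := by rw [this]; ring
    _ = B₀ * s := by rw [ENNReal.tsum_mul_left, hB₀]; ring
    _ ≤ _ := by
        gcongr
        rw [ENNReal.coe_add, ENNReal.coe_toNNReal hB₀top]
        exact le_self_add

/-! ### Covering by balls of large average -/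

/-- The balls on which an integrable function has average at least `s` have bounded radii. -/
lemma exists_radius_le_of_mul_volume_closedBall_le (hn : 1 ≤ n) {G : Euc n → ℝ≥0∞} {s : ℝ≥0∞}
    (hG : ∫⁻ y, G y ≠ ∞) (hs0 : s ≠ 0) (hs : s ≠ ∞) :
    ∃ M : ℝ, ∀ (x : Euc n) (r : ℝ), 0 < r →
      s * volume (closedBall x r) ≤ ∫⁻ y in closedBall x r, G y → r ≤ M := by
  set w := volume (closedBall (0 : Euc n) 1) with hw
  have hwtop : w ≠ ∞ := measure_closedBall_lt_top.ne
  have hw0 : w ≠ 0 := (measure_closedBall_pos volume _ one_pos).ne'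
  have hsw0 : s * w ≠ 0 := mul_ne_zero hs0 hw0
  have hswtop : s * w ≠ ∞ := ENNReal.mul_ne_top hs hwtop
  -- The `1` ensures `r ≤ r ^ n` for any radius exceeding the bound.
  refine ⟨max 1 ((∫⁻ y, G y) / (s * w)).toReal, fun x r hb0 hb1 => ?_⟩
  by_contra! h
  have h1 : 1 < r := (le_max_left _ _).trans_lt h
  have h2 : ((∫⁻ y, G y) / (s * w)).toReal < r ^ n :=
    ((le_max_right _ _).trans_lt h).trans_le (le_self_pow₀ h1.le (by omega))
  rw [volume_closedBall_eq _ hb0.le, ← hw] at hb1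
  have h3 : ENNReal.ofReal (r ^ n) ≤ (∫⁻ y, G y) / (s * w) := by
    rw [ENNReal.le_div_iff_mul_le (Or.inl hsw0) (Or.inl hswtop)]
    calc _ = s * (ENNReal.ofReal (r ^ n) * w) := by ring
      _ ≤ _ := hb1.trans (setLIntegral_le_lintegral _ _)
  exact absurd ((ENNReal.ofReal_le_iff_le_toReal (ENNReal.div_ne_top hG hsw0)).1 h3) (not_le.2 h2)

/-- Vitali covering estimate for a family of balls on which `G` has average at least `s`. -/
lemma mul_volume_biUnion_closedBall_le (hn : 1 ≤ n) {G : Euc n → ℝ≥0∞} {s : ℝ≥0∞}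
    (hG : ∫⁻ y, G y ≠ ∞) (hs0 : s ≠ 0) (hs : s ≠ ∞) (S : Set (Euc n × ℝ))
    (hS : ∀ b ∈ S, 0 < b.2 ∧ s * volume (closedBall b.1 b.2) ≤ ∫⁻ y in closedBall b.1 b.2, G y) :
    s * volume (⋃ b ∈ S, closedBall b.1 b.2) ≤ 5 ^ n * ∫⁻ y, G y := by
  obtain ⟨M, hM⟩ := exists_radius_le_of_mul_volume_closedBall_le hn hG hs0 hs
  obtain ⟨u, huS, hdisj, hcov⟩ := Vitali.exists_disjoint_subfamily_covering_enlargement_closedBall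
    S Prod.fst Prod.snd M
    (fun b hb => hM b.1 b.2 (hS b hb).1 (hS b hb).2) 5 (by norm_num)
  have hcount : u.Countable := hdisj.countable_of_nonempty_interior fun b hb =>
    (nonempty_ball.2 (hS b (huS hb)).1).mono ball_subset_interior_closedBall
  calc s * volume (⋃ b ∈ S, closedBall b.1 b.2)
      ≤ s * volume (⋃ b ∈ u, closedBall b.1 (5 * b.2)) := by
        refine mul_le_mul_right (measure_mono ?_) _
        intro y hy
        obtain ⟨b, hb, hyb⟩ := Set.mem_iUnion₂.1 hy
        obtain ⟨d, hd, hbd⟩ := hcov b hb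
        exact Set.mem_iUnion₂.2 ⟨d, hd, hbd hyb⟩
    _ ≤ s * ∑' b : u, volume (closedBall b.1.1 (5 * b.1.2)) :=
        mul_le_mul_right (measure_biUnion_le _ hcount _) _
    _ = ∑' b : u, 5 ^ n * (s * volume (closedBall b.1.1 b.1.2)) := by
        rw [← ENNReal.tsum_mul_left]
        congr with b
        have hb0 := (hS b (huS b.2)).1
        rw [volume_closedBall_eq _ (by positivity), volume_closedBall_eq _ hb0.le, mul_pow,
          ENNReal.ofReal_mul (by positivity), ENNReal.ofReal_pow (by positivity),
          ENNReal.ofReal_ofNat]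
        ring
    _ ≤ ∑' b : u, 5 ^ n * ∫⁻ y in closedBall b.1.1 b.1.2, G y := by
        gcongr with b
        exact (hS b (huS b.2)).2
    _ = 5 ^ n * ∫⁻ y in ⋃ b ∈ u, closedBall b.1 b.2, G y := by
        rw [ENNReal.tsum_mul_left,
          lintegral_biUnion hcount (fun _ _ => measurableSet_closedBall) hdisj]
    _ ≤ _ := mul_le_mul_right (setLIntegral_le_lintegral _ _) _

/-! ### From volume to capacity -/

/-- At distance less than `t` the kernel is at least a constant times `t ^ (-n)`, so its mass on
`ball x t` is bounded below independently of scale. This makes `κ⁻¹` times the indicator of `A` a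
test function for the capacity. -/
lemma exists_le_setIntegral_poissonKernel (n : ℕ) (hα : 0 < α) :
    ∃ κ : ℝ, 0 < κ ∧ ∀ (x : Euc n) (t : ℝ), 0 < t → ∀ A : Set (Euc n), MeasurableSet A →
      volume A ≠ ∞ → ball x t ⊆ A →
      κ ≤ ∫ y, poissonKernel α t (x - y) * A.indicator 1 y := by
  have hc := normConst_pos n hα
  set v := volume.real (ball (0 : Euc n) 1) with hv
  have hvpos : 0 < v := ENNReal.toReal_pos (measure_ball_pos _ _ one_pos).ne' measure_ball_lt_top.ne
  refine ⟨normConst n α / 2 ^ (((n : ℝ) + α) / 2) * v, by positivity,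
    fun x t ht A hA hAtop hsub => ?_⟩
  have hcont : Continuous fun y : Euc n => poissonKernel α t (x - y) := by
    unfold poissonKernel
    refine continuous_const.div (Continuous.rpow_const (by fun_prop) fun y => Or.inl ?_)
      fun y => ?_ <;> positivity
  have hle : ∀ y : Euc n, poissonKernel α t y ≤
      normConst n α * t ^ α / (t ^ 2) ^ (((n : ℝ) + α) / 2) := by
    intro y
    unfold poissonKernel
    gcongr
    nlinarith [sq_nonneg ‖y‖]
  have hint : IntegrableOn (fun y => poissonKernel α t (x - y)) A volume := by
    refine Measure.integrableOn_of_bounded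
      (M := normConst n α * t ^ α / (t ^ 2) ^ (((n : ℝ) + α) / 2)) hAtop
      hcont.aestronglyMeasurable (Filter.Eventually.of_forall fun y => ?_)
    rw [Real.norm_of_nonneg (poissonKernel_pos hα ht _).le]
    exact hle _
  have heq : (fun y => poissonKernel α t (x - y) * A.indicator 1 y) =
      A.indicator fun y => poissonKernel α t (x - y) := by
    ext y
    by_cases hy : y ∈ A <;> simp [hy]
  rw [heq, integral_indicator hA]
  calc normConst n α / 2 ^ (((n : ℝ) + α) / 2) * v
      = ∫ _ in ball x t, normConst n α * t ^ α / (2 * t ^ 2) ^ (((n : ℝ) + α) / 2) := by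
        rw [setIntegral_const, smul_eq_mul, measureReal_def, Measure.addHaar_ball_of_pos volume x ht,
          ENNReal.toReal_mul, ENNReal.toReal_ofReal (by positivity), ← measureReal_def, ← hv,
          Real.mul_rpow zero_le_two (by positivity), ← Real.rpow_natCast t 2,
          ← Real.rpow_mul ht.le, finrank_euclideanSpace_fin]
        have : ((2 : ℕ) : ℝ) * (((n : ℝ) + α) / 2) = n + α := by push_cast; ring
        rw [this, Real.rpow_add ht, Real.rpow_natCast]
        have : t ^ α ≠ 0 := by positivity
        field_simp
    _ ≤ ∫ y in ball x t, poissonKernel α t (x - y) := by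
        refine setIntegral_mono_on (integrableOn_const measure_ball_lt_top.ne) (hint.mono_set hsub)
          measurableSet_ball fun y hy => ?_
        have hxy : ‖x - y‖ ≤ t := by
          rw [mem_ball, dist_comm, dist_eq_norm] at hy
          exact hy.le
        unfold poissonKernel
        gcongr
        nlinarith [norm_nonneg (x - y)]
    _ ≤ _ := setIntegral_mono_set hint
        (Filter.Eventually.of_forall fun y => (poissonKernel_pos hα ht _).le)
        hsub.eventuallyLE

/-- The capacity of a set is controlled by the volume of any set containing the bases of its
tents. -/
lemma exists_capacity_le (n : ℕ) (hα : 0 < α) (hp : 0 < p) :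
    ∃ D : ℝ≥0, ∀ (E : Set (HalfSpace n)) (A : Set (Euc n)), MeasurableSet A → volume A ≠ ∞ →
      (∀ z ∈ E, ball z.1 (z.2 : ℝ) ⊆ A) → capacity α p E ≤ D * volume A := by
  obtain ⟨κ, hκ, hκle⟩ := exists_le_setIntegral_poissonKernel n hα
  refine ⟨‖κ⁻¹‖₊ ^ p, fun E A hA hAtop hE => ?_⟩
  have hpE : ENNReal.ofReal p ≠ 0 := by simpa using hp
  have hmem : A.indicator (fun _ => κ⁻¹) ∈ admissible α p E := by
    refine ⟨memLp_indicator_const _ hA _ (Or.inr hAtop), Filter.Eventually.of_forall fun y =>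
      Set.indicator_nonneg (fun _ _ => by positivity) y, fun z hz => ?_⟩
    have h := hκle z.1 z.2 z.2.2 A hA hAtop (hE z hz)
    have heq : (fun y => poissonKernel α (z.2 : ℝ) (z.1 - y) * A.indicator (fun _ => κ⁻¹) y) =
        fun y => κ⁻¹ * (poissonKernel α (z.2 : ℝ) (z.1 - y) * A.indicator 1 y) := by
      ext y
      by_cases hy : y ∈ A <;> simp [hy, mul_comm]
    rw [extension, heq, integral_const_mul, inv_mul_eq_div, one_le_div hκ]
    exact h
  rw [capacity, if_pos ⟨_, hmem⟩]
  refine (iInf₂_le _ hmem).trans_eq ?_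
  rw [eLpNorm_indicator_const hA hpE ENNReal.ofReal_ne_top, ENNReal.toReal_ofReal hp.le,
    ENNReal.mul_rpow_of_nonneg _ _ hp.le, ← ENNReal.rpow_mul, one_div, inv_mul_cancel₀ hp.ne',
    ENNReal.rpow_one, ENNReal.coe_rpow_of_nonneg _ hp.le, enorm_eq_nnnorm]

end CaffarelliSilvestre

/-! ### Capacitary weak-type estimate and its integration -/

namespace CaffarelliSilvestre

open Metric

/-- Restricting the integral to large values of `f` is what makes the bound integrable against `l ^
(p - 1)`. -/
lemma exists_capacity_superlevel_le {n : ℕ} {α p : ℝ} (hn : 1 ≤ n) (hα : 0 < α) (hp : 0 < p) :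
    ∃ D : ℝ≥0, ∃ K : ℝ, 0 < K ∧ ∀ f : Euc n → ℝ, AEStronglyMeasurable f volume → ∀ l : ℝ, 0 < l →
      capacity α p {z : HalfSpace n | l ≤ extension α f z} ≤
        D * ENNReal.ofReal l⁻¹ * ∫⁻ y in {y | l < K * ‖f y‖}, ‖f y‖ₑ := by
  obtain ⟨B, hB, hBle⟩ := exists_lintegral_poissonKernel_le n hα
  obtain ⟨D, hD⟩ := exists_capacity_le n hα hp
  have hB' : (0 : ℝ) < B := hB
  -- `D + 1` keeps the constant nonzero, so the bound is trivially `∞` when the integral diverges.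
  refine ⟨(D + 1) * 5 ^ n * (4 * B), 4 * B, by positivity, fun f hf l hl => ?_⟩
  set T := {y | l < 4 * B * ‖f y‖} with hT
  by_cases htop : ∫⁻ y in T, ‖f y‖ₑ = ∞
  · rw [htop, ENNReal.mul_top]
    · exact le_top
    · refine mul_ne_zero (by exact_mod_cast (by positivity)) ?_
      simpa using hl
  set G : Euc n → ℝ≥0∞ := T.indicator fun y => ‖f y‖ₑ with hG
  have hGle : ∫⁻ y, G y ≤ ∫⁻ y in T, ‖f y‖ₑ := lintegral_indicator_le _ _
  -- If every average of `G` were below `a`, those of `‖f‖` would be at most `2 * a`, and the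
  -- extension at most `2 * a * B = l / 2 < l`.
  set a : ℝ≥0 := (l / (4 * B)).toNNReal with ha
  have hapos : 0 < a := by rw [ha, Real.toNNReal_pos]; positivity
  have hpt : ∀ y, ‖f y‖ₑ ≤ a + G y := by
    intro y
    by_cases hy : y ∈ T
    · rw [hG, Set.indicator_of_mem hy]
      exact le_add_self
    · refine le_add_right ?_
      rw [hT, Set.mem_ofPred_eq, not_lt] at hy
      rw [← ofReal_norm]
      exact ENNReal.ofReal_le_ofReal ((le_div_iff₀' (by positivity)).2 hy)
  set S : Set (Euc n × ℝ) := {b | 0 < b.2 ∧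
    a * volume (closedBall b.1 b.2) ≤ ∫⁻ y in closedBall b.1 b.2, G y} with hS
  set E := {z : HalfSpace n | l ≤ extension α f z} with hE
  set A : Set (Euc n) := ⋃ z ∈ E, ball z.1 (z.2 : ℝ) with hA
  have hex : ∀ z ∈ E, ∃ r, (z.2 : ℝ) ≤ r ∧ (z.1, r) ∈ S := by
    intro z hz
    have ht : 0 < (z.2 : ℝ) := z.2.2
    by_contra! hcon
    have havg : ∀ r, (z.2 : ℝ) ≤ r → ∫⁻ y in closedBall z.1 r, ‖f y‖ₑ ≤
        ((2 * a : ℝ≥0) : ℝ≥0∞) * volume (closedBall z.1 r) := by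
      intro r hr
      have h1 : ∫⁻ y in closedBall z.1 r, G y < a * volume (closedBall z.1 r) := by
        by_contra! h
        exact hcon r hr ⟨ht.trans_le hr, h⟩
      calc ∫⁻ y in closedBall z.1 r, ‖f y‖ₑ
          ≤ ∫⁻ y in closedBall z.1 r, (a + G y) := lintegral_mono fun y => hpt y
        _ = a * volume (closedBall z.1 r) + ∫⁻ y in closedBall z.1 r, G y := by
            rw [lintegral_add_left measurable_const, setLIntegral_const]
        _ ≤ a * volume (closedBall z.1 r) + a * volume (closedBall z.1 r) := by gcongr
        _ = _ := by rw [ENNReal.coe_mul, ENNReal.coe_ofNat]; ring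
    have h2 := hBle z.1 z.2 ht (fun y => ‖f y‖ₑ) (2 * a : ℝ≥0) hf.enorm havg
    have h3 : ENNReal.ofReal l ≤ ((B * (2 * a) : ℝ≥0) : ℝ≥0∞) := by
      calc ENNReal.ofReal l ≤ ENNReal.ofReal (extension α f z) := ENNReal.ofReal_le_ofReal hz
        _ ≤ ‖extension α f z‖ₑ := Real.ofReal_le_enorm _
        _ ≤ ∫⁻ y, ‖poissonKernel α (z.2 : ℝ) (z.1 - y) * f y‖ₑ :=
            enorm_integral_le_lintegral_enorm _
        _ ≤ _ := by
            simp only [enorm_mul]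
            rw [ENNReal.coe_mul B]
            exact h2
    rw [ENNReal.ofReal_le_coe] at h3
    push_cast at h3
    rw [ha, Real.coe_toNNReal _ (by positivity)] at h3
    field_simp at h3
    linarith
  have hAS : A ⊆ ⋃ b ∈ S, closedBall b.1 b.2 := by
    intro y hy
    obtain ⟨z, hz, hyz⟩ := Set.mem_iUnion₂.1 hy
    obtain ⟨r, hr, hrS⟩ := hex z hz
    exact Set.mem_iUnion₂.2
      ⟨(z.1, r), hrS, closedBall_subset_closedBall hr (ball_subset_closedBall hyz)⟩
  have hweak : a * volume A ≤ 5 ^ n * ∫⁻ y in T, ‖f y‖ₑ :=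
    calc a * volume A ≤ a * volume (⋃ b ∈ S, closedBall b.1 b.2) := by gcongr
      _ ≤ 5 ^ n * ∫⁻ y, G y := mul_volume_biUnion_closedBall_le hn
          (ne_top_of_le_ne_top htop hGle) (by exact_mod_cast hapos.ne') ENNReal.coe_ne_top S
          fun b hb => hb
      _ ≤ _ := by gcongr
  have hvol : volume A ≤ 5 ^ n * (∫⁻ y in T, ‖f y‖ₑ) / a := by
    rw [ENNReal.le_div_iff_mul_le (Or.inl (by exact_mod_cast hapos.ne'))
      (Or.inl ENNReal.coe_ne_top), mul_comm]
    exact hweak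
  have hAtop : volume A ≠ ∞ := ne_top_of_le_ne_top
    (ENNReal.div_ne_top (ENNReal.mul_ne_top (by simp) htop) (by exact_mod_cast hapos.ne')) hvol
  have hainv : ((a : ℝ≥0∞))⁻¹ = ((4 * B : ℝ≥0) : ℝ≥0∞) * ENNReal.ofReal l⁻¹ := by
    have : (a : ℝ≥0∞) = ENNReal.ofReal (l / (4 * B)) := rfl
    rw [this, ← ENNReal.ofReal_inv_of_pos (by positivity), ← ENNReal.ofReal_coe_nnreal,
      ← ENNReal.ofReal_mul (by positivity)]
    congr 1
    push_cast
    field_simp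
  calc capacity α p E ≤ D * volume A := hD E A
        (isOpen_biUnion fun _ _ => isOpen_ball).measurableSet hAtop
        fun z hz y hy => Set.mem_iUnion₂.2 ⟨z, hz, hy⟩
    _ ≤ (D + 1) * (5 ^ n * (∫⁻ y in T, ‖f y‖ₑ) / a) := by
        gcongr
        exact le_self_add
    _ = _ := by
        rw [div_eq_mul_inv, hainv]
        push_cast
        ring

end CaffarelliSilvestre

/-- Capacitary strong-type inequality; `d(λ^p)` on `(0, ∞)` is `p λ^{p-1} dλ`. -/
theorem mainTheorem7 (n : ℕ) (hn : 1 ≤ n) (α : ℝ) (hα0 : 0 < α) (hα2 : α < 2)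
    (p : ℝ) (hp : 1 < p) :
    ∃ C : ℝ≥0, ∀ f : CaffarelliSilvestre.Euc n → ℝ,
      MemLp f (ENNReal.ofReal p) volume → 0 ≤ᵐ[volume] f →
      ∫⁻ l in Set.Ioi (0 : ℝ),
          CaffarelliSilvestre.capacity α p
            {z : CaffarelliSilvestre.HalfSpace n | l ≤ CaffarelliSilvestre.extension α f z} *
          ENNReal.ofReal (p * l ^ (p - 1))
        ≤ (C : ℝ≥0∞) * eLpNorm f (ENNReal.ofReal p) volume ^ p := by

  obtain ⟨D, K, hK, hDK⟩ := CaffarelliSilvestre.exists_capacity_superlevel_le (p := p) hn hα0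
    (by linarith)
  have hp0 : 0 < p := by linarith
  have hp1 : 0 < p - 1 := by linarith
  refine ⟨D * (p / (p - 1) * K ^ (p - 1)).toNNReal, fun f hf _ => ?_⟩
  -- With `ν = |f| dy`, the truncated integral is the distribution function of `K * ‖f‖` under `ν`,
  -- so the layer-cake formula with exponent `p - 1` recovers `∫ |f| ^ p`.
  set ν : Measure (CaffarelliSilvestre.Euc n) := volume.withDensity fun y => ‖f y‖ₑ with hν
  have hcake := lintegral_rpow_eq_lintegral_meas_lt_mul ν (f := fun y => K * ‖f y‖)
    (Filter.Eventually.of_forall fun y => by positivity)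
    ((hf.1.norm.aemeasurable.const_mul K).mono_ac (withDensity_absolutelyContinuous _ _)) hp1
  have hleft : ∫⁻ y, ENNReal.ofReal ((K * ‖f y‖) ^ (p - 1)) ∂ν =
      ENNReal.ofReal (K ^ (p - 1)) * eLpNorm f (ENNReal.ofReal p) volume ^ p := by
    rw [hν, lintegral_withDensity_eq_lintegral_mul₀ hf.1.enorm
      (((hf.1.norm.aemeasurable.const_mul K).pow_const _).ennreal_ofReal),
      eLpNorm_eq_lintegral_rpow_enorm_toReal (by simpa using hp0) ENNReal.ofReal_ne_top,
      ENNReal.toReal_ofReal hp0.le, ← ENNReal.rpow_mul, one_div, inv_mul_cancel₀ hp0.ne',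
      ENNReal.rpow_one, ← lintegral_const_mul' _ _ ENNReal.ofReal_ne_top]
    congr with y
    rw [Pi.mul_apply, Real.mul_rpow hK.le (norm_nonneg _), ENNReal.ofReal_mul (by positivity),
      ← ENNReal.ofReal_rpow_of_nonneg (norm_nonneg _) hp1.le, ofReal_norm]
    have : ‖f y‖ₑ ^ p = ‖f y‖ₑ * ‖f y‖ₑ ^ (p - 1) := by
      conv_rhs => rw [← ENNReal.rpow_one ‖f y‖ₑ, ← ENNReal.rpow_mul, one_mul,
        ← ENNReal.rpow_add_of_nonneg _ _ zero_le_one hp1.le, add_sub_cancel]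
    rw [this]
    ring
  calc _ ≤ ∫⁻ l in Set.Ioi (0 : ℝ), (D * ENNReal.ofReal p) *
        (ν {y | l < K * ‖f y‖} * ENNReal.ofReal (l ^ (p - 1 - 1))) := by
        refine setLIntegral_mono' measurableSet_Ioi fun l hl => ?_
        have hl0 : 0 < l := hl
        rw [hν, withDensity_apply']
        have hpow : ENNReal.ofReal (p * l ^ (p - 1)) * ENNReal.ofReal l⁻¹ =
            ENNReal.ofReal p * ENNReal.ofReal (l ^ (p - 1 - 1)) := by
          rw [← ENNReal.ofReal_mul (by positivity), ← ENNReal.ofReal_mul hp0.le,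
            Real.rpow_sub_one hl0.ne' (p - 1), div_eq_mul_inv, mul_assoc]
        calc _ ≤ (D * ENNReal.ofReal l⁻¹ * ∫⁻ y in {y | l < K * ‖f y‖}, ‖f y‖ₑ) *
              ENNReal.ofReal (p * l ^ (p - 1)) := by
              gcongr
              exact hDK f hf.1 l hl0
          _ = D * (∫⁻ y in {y | l < K * ‖f y‖}, ‖f y‖ₑ) *
              (ENNReal.ofReal (p * l ^ (p - 1)) * ENNReal.ofReal l⁻¹) := by ring
          _ = _ := by rw [hpow]; ring
    _ = D * ENNReal.ofReal p * ((ENNReal.ofReal (p - 1))⁻¹ *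
        ∫⁻ y, ENNReal.ofReal ((K * ‖f y‖) ^ (p - 1)) ∂ν) := by
        rw [lintegral_const_mul' _ _ (ENNReal.mul_ne_top ENNReal.coe_ne_top ENNReal.ofReal_ne_top),
          hcake, ← mul_assoc (ENNReal.ofReal (p - 1))⁻¹,
          ENNReal.inv_mul_cancel (by simpa using hp1) ENNReal.ofReal_ne_top, one_mul]
    _ = _ := by
        rw [hleft, ENNReal.coe_mul]
        change _ = D * ENNReal.ofReal (p / (p - 1) * K ^ (p - 1)) * _
        rw [ENNReal.ofReal_mul (by positivity), ENNReal.ofReal_div_of_pos hp1, div_eq_mul_inv]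
        ring
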